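/- **Theorem 4.1.** Let $p>3$ be a prime, and let $R_p$ be the ring of rational numbers whose denominator is coprime to $p$. Let $m\in R_p$ with $m\not\equiv 0\pmod p$ (that is, $m\notin pR_p$), and let $t\in\mathbb C$ be a square root of $1-1728/m$, so $t^2=1-1728/m$. Let $P_n$ denote the Legendre polynomials, $P_0(x)=1$, $P_1(x)=x$, $(n+1)P_{n+1}(x)=(2n+1)xP_n(x)-nP_{n-1}(x)$ for $n\ge 1$, and let $[\cdot]$ be the greatest integer function. For algebraic numbers $a,b$ we write $a\equiv b\pmod p$ if $(a-b)/p$ is integral over $R_p$. Then $$\sum_{k=0}^{p-1}\frac{\binom{2k}k\binom{3k}k\binom{6k}{3k}}{m^k}\equiv P_{[p/6]}(t)^2\equiv\Big(\sum_{x=0}^{p-1}(x^3-3x+2t)^{\frac{p-1}2}\Big)^2\pmod p.$$ Moreover, if $P_{[p/6]}(t)\equiv 0\pmod p$ or $\sum_{x=0}^{p-1}(x^3-3x+2t)^{\frac{p-1}2}\equiv 0\pmod p$, then $$\sum_{k=0}^{p-1}\frac{\binom{2k}k\binom{3k}k\binom{6k}{3k}}{m^k}\equiv 0\pmod{p^2},$$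 that is, this sum lies in $p^2R_p$. -/

import Mathlib

open Polynomial

/-- The ring `R_p` of rational numbers whose denominator is coprime to `p`. -/
def Rp (p : ℕ) : Subring ℚ where
  carrier := {q | Nat.Coprime q.den p}
  zero_mem' := by simp
  one_mem' := by simp
  add_mem' := fun {a b} ha hb =>
    Nat.Coprime.coprime_dvd_left (Rat.add_den_dvd a b) (Nat.Coprime.mul_left ha hb)
  mul_mem' := fun {a b} ha hb =>
    Nat.Coprime.coprime_dvd_left (Rat.mul_den_dvd a b) (Nat.Coprime.mul_left ha hb)
  neg_mem' := fun {a} ha => by simpa using ha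

/-- Congruence of rational numbers modulo `N` in the ring `R_p`: the difference is `N` times an
element of `R_p`. -/
def RatCongr (p N : ℕ) (a b : ℚ) : Prop :=
  ∃ c : ℚ, c ∈ Rp p ∧ a - b = (N : ℚ) * c

/-- Congruence of algebraic numbers modulo `N`: the difference is `N` times a `p`-integral
algebraic number, i.e. a complex number that is integral over `R_p`. -/
def AlgCongr (p N : ℕ) (a b : ℂ) : Prop :=
  ∃ c : ℂ, IsIntegral (Rp p) c ∧ a - b = (N : ℂ) * c

/-- The Legendre polynomials: `P_0 = 1`, `P_1 = X` and
`(n + 1) P_{n+1} = (2 n + 1) X P_n - n P_{n-1}` for `n ≥ 1`. -/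
noncomputable def legendreP : ℕ → ℚ[X]
  | 0 => 1
  | 1 => X
  | n + 2 => C (1 / ((n : ℚ) + 2)) *
      (C (2 * (n : ℚ) + 3) * X * legendreP (n + 1) - C ((n : ℚ) + 1) * legendreP n)

/-- The sum `∑_{k=0}^{p-1} C(2k,k) C(3k,k) C(6k,3k) / m^k`. -/
def binomSum (p : ℕ) (m : ℚ) : ℚ :=
  ∑ k ∈ Finset.range p,
    ((Nat.choose (2 * k) k * Nat.choose (3 * k) k * Nat.choose (6 * k) (3 * k) : ℕ) : ℚ) / m ^ k

/-- The sum `∑_{x=0}^{p-1} (x^3 - 3x + 2t)^((p-1)/2)`. -/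
noncomputable def cubicSum (p : ℕ) (t : ℂ) : ℂ :=
  ∑ x ∈ Finset.range p, ((x : ℂ) ^ 3 - 3 * (x : ℂ) + 2 * t) ^ ((p - 1) / 2)

/-! Put `x = (1 - t) / 864`, so that `x (1 - 432 x) = 1 / m`, and let `F(x)` be the series with
coefficients `C(3k,k) C(6k,3k)`, cut off below degree `p`. Clausen's formula says that the square of
the full series is the series of `binomSum` in `x (1 - 432 x)`. The truncations satisfy it modulo `p
^ 2` as integer polynomials (`clausen_sub_dvd`): coefficients below degree `p` agree exactly, and
the others are divisible by `p ^ 2`. Hence `binomSum ≡ F(x) ^ 2` modulo `p ^ 2`.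

Since `p ≡ ±1` modulo 6, the coefficients of `F` reduce modulo `p` to those of `P_[p/6]` in powers
of `(t - 1) / 2 = -432 x` (`legendreCoeff_zmod_eq_sexticCoeff`), so `F(x) ≡ P_[p/6](t)`. Power sums
over `ZMod p` turn the cubic sum `S` into the same polynomial up to a factor: `P_[p/6](t) ≡ -3 ^
((p-1)/2) S` (`legendre_eq_sum_cubic_pow`). Squaring removes the factor by Fermat. If `P_[p/6](t)`
or `S` vanishes modulo `p`, so does `F(x)`, and then `F(x) ^ 2` vanishes modulo `p ^ 2`. -/

/-- The coefficients `C(3k,k) C(6k,3k)` of the hypergeometric series `₂F₁(1/6, 5/6; 1; 432 x)`. -/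
def sexticCoeff (k : ℕ) : ℕ := Nat.choose (3 * k) k * Nat.choose (6 * k) (3 * k)

/-- The coefficients `C(2k,k) C(3k,k) C(6k,3k)` of `₃F₂(1/6, 1/2, 5/6; 1, 1; 1728 x)`. -/
def clausenCoeff (k : ℕ) : ℕ := Nat.choose (2 * k) k * sexticCoeff k

/-- The coefficients of the Legendre polynomial `P_n` in powers of `(t - 1) / 2`. -/
def legendreCoeff (n k : ℕ) : ℕ := Nat.choose n k * Nat.choose (n + k) k

/-! ### Coefficient recurrences and the expansion of Legendre polynomials -/

theorem sexticCoeff_mul_factorial (k : ℕ) :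
    sexticCoeff k * (k.factorial * (2 * k).factorial * (3 * k).factorial) =
      (6 * k).factorial := by
  have h1 := Nat.choose_mul_factorial_mul_factorial (show k ≤ 3 * k by omega)
  have h2 := Nat.choose_mul_factorial_mul_factorial (show 3 * k ≤ 6 * k by omega)
  rw [show 3 * k - k = 2 * k by omega] at h1
  rw [show 6 * k - 3 * k = 3 * k by omega] at h2
  rw [← h2]
  nth_rw 2 [← h1]
  unfold sexticCoeff
  ring

theorem sexticCoeff_succ (k : ℕ) :
    (k + 1) ^ 2 * sexticCoeff (k + 1) = 12 * (6 * k + 1) * (6 * k + 5) * sexticCoeff k := by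
  have h1 := sexticCoeff_mul_factorial k
  have h2 := sexticCoeff_mul_factorial (k + 1)
  rw [show 2 * (k + 1) = 2 * k + 1 + 1 by ring, show 3 * (k + 1) = 3 * k + 1 + 1 + 1 by ring,
    show 6 * (k + 1) = 6 * k + 1 + 1 + 1 + 1 + 1 + 1 by ring] at h2
  simp only [Nat.factorial_succ] at h2
  rw [← h1] at h2
  have hpos : 0 < (k.factorial * (2 * k).factorial * (3 * k).factorial) *
      (6 * (2 * k + 1) * (3 * k + 1) * (3 * k + 2) * (k + 1)) := by positivity
  apply Nat.eq_of_mul_eq_mul_right hpos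
  linear_combination h2

theorem clausenCoeff_succ (k : ℕ) :
    (k + 1) ^ 3 * clausenCoeff (k + 1) =
      24 * (2 * k + 1) * (6 * k + 1) * (6 * k + 5) * clausenCoeff k := by
  have h1 := sexticCoeff_succ k
  have h2 := Nat.succ_mul_centralBinom_succ k
  simp only [Nat.centralBinom] at h2
  unfold clausenCoeff
  calc _ = ((k + 1) * (2 * (k + 1)).choose (k + 1)) * ((k + 1) ^ 2 * sexticCoeff (k + 1)) := by
        ring
    _ = _ := by rw [h1, h2]; ring

theorem legendreCoeff_succ_right (n k : ℕ) :
    ((k : ℤ) + 1) ^ 2 * legendreCoeff n (k + 1) = (n - k) * (n + k + 1) * legendreCoeff n k := by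
  have h1 : ((n.choose (k + 1) : ℤ)) * (k + 1) = n.choose k * (n - k) := by
    rcases le_or_gt k n with h | h
    · have := Nat.choose_succ_right_eq n k
      zify [h] at this
      exact this
    · rw [Nat.choose_eq_zero_of_lt h, Nat.choose_eq_zero_of_lt (by omega)]
      simp
  have h2 : ((n + (k + 1)).choose (k + 1) : ℤ) * (k + 1) = (n + k + 1) * (n + k).choose k := by
    have := Nat.add_one_mul_choose_eq (n + k) k
    zify at this
    rw [← add_assoc, ← this]
  unfold legendreCoeff
  push_cast
  linear_combination ((n + (k + 1)).choose (k + 1) : ℤ) * (k + 1) * h1 + (n.choose k * (n - k)) * h2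

theorem legendreCoeff_zero_right (n : ℕ) : legendreCoeff n 0 = 1 := by simp [legendreCoeff]

theorem legendreCoeff_succ_left (n k : ℕ) :
    ((n : ℤ) + 1 - k) * legendreCoeff (n + 1) k = (n + 1 + k) * legendreCoeff n k := by
  induction k with
  | zero => simp [legendreCoeff]
  | succ k ih =>
    have h1 := legendreCoeff_succ_right n k
    have h2 := legendreCoeff_succ_right (n + 1) k
    have hk : ((k : ℤ) + 1) ^ 2 ≠ 0 := by positivity
    apply mul_left_cancel₀ hk
    push_cast at *
    linear_combination (n - k : ℤ) * h2 - (n + 1 + (k + 1) : ℤ) * h1 +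
      (n - k : ℤ) * (n + 1 + k + 1) * ih

/-- Compares coefficients of `z ^ (k + 1)`, `z = (t - 1) / 2`, in the Legendre recurrence, where `t
= 1 + 2 z`. -/
theorem legendreCoeff_three_term (n k : ℕ) :
    ((n : ℤ) + 2) * legendreCoeff (n + 2) (k + 1) =
      (2 * n + 3) * (legendreCoeff (n + 1) (k + 1) + 2 * legendreCoeff (n + 1) k) -
        (n + 1) * legendreCoeff n (k + 1) := by
  have h0 := legendreCoeff_succ_right n k
  have h1 := legendreCoeff_succ_right (n + 1) k
  have h2 := legendreCoeff_succ_right (n + 2) k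
  have h3 := legendreCoeff_succ_left n k
  have h4 := legendreCoeff_succ_left (n + 1) k
  have hk : ((k : ℤ) + 1) ^ 2 ≠ 0 := by positivity
  apply mul_left_cancel₀ hk
  push_cast at *
  linear_combination (n + 2 : ℤ) * h2 + (n + 1 : ℤ) * h0 - (2 * n + 3 : ℤ) * h1 +
    (n + 2 : ℤ) * (n + k + 3) * h4 - (n + 1 : ℤ) * (n - k) * h3

theorem legendreCoeff_eq_zero {n k : ℕ} (h : n < k) : legendreCoeff n k = 0 := by
  simp [legendreCoeff, Nat.choose_eq_zero_of_lt h]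

theorem aeval_legendreP (t : ℂ) (n N : ℕ) (hN : n < N) :
    aeval t (legendreP n) =
      ∑ k ∈ Finset.range N, (legendreCoeff n k : ℂ) * ((t - 1) / 2) ^ k := by
  -- One bound `N` serves all three consecutive degrees in the induction.
  suffices H : ∀ N n, n ≤ N → aeval t (legendreP n) =
      ∑ k ∈ Finset.range (N + 1), (legendreCoeff n k : ℂ) * ((t - 1) / 2) ^ k by
    obtain ⟨M, rfl⟩ : ∃ M, N = M + 1 := ⟨N - 1, by omega⟩
    exact H M n (by omega)
  clear N hN n
  intro N n
  induction n using Nat.twoStepInduction with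
  | zero =>
    intro h
    rw [Finset.sum_range_succ', Finset.sum_eq_zero]
    · simp [legendreP, legendreCoeff]
    · intro k _
      rw [legendreCoeff_eq_zero (by omega)]; simp
  | one =>
    intro h
    obtain ⟨M, rfl⟩ : ∃ M, N = M + 1 := ⟨N - 1, by omega⟩
    rw [Finset.sum_range_succ', Finset.sum_range_succ', Finset.sum_eq_zero]
    · simp [legendreP, legendreCoeff]
      ring
    · intro k _
      rw [legendreCoeff_eq_zero (by omega)]; simp
  | more n ih0 ih1 =>
    intro h
    have hn : ((n : ℂ) + 2) ≠ 0 := by exact_mod_cast (by omega : n + 2 ≠ 0)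
    have key : ((n : ℂ) + 2) *
        ∑ k ∈ Finset.range (N + 1), (legendreCoeff (n + 2) k : ℂ) * ((t - 1) / 2) ^ k =
        (2 * n + 3) * t *
          ∑ k ∈ Finset.range (N + 1), (legendreCoeff (n + 1) k : ℂ) * ((t - 1) / 2) ^ k -
        (n + 1) * ∑ k ∈ Finset.range (N + 1), (legendreCoeff n k : ℂ) * ((t - 1) / 2) ^ k := by
      have ht : (2 * n + 3) * t *
          ∑ k ∈ Finset.range (N + 1), (legendreCoeff (n + 1) k : ℂ) * ((t - 1) / 2) ^ k =
          (2 * n + 3) *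
          ∑ k ∈ Finset.range (N + 1), (legendreCoeff (n + 1) k : ℂ) * ((t - 1) / 2) ^ k +
          (2 * n + 3) * 2 *
          ∑ k ∈ Finset.range N, (legendreCoeff (n + 1) k : ℂ) * ((t - 1) / 2) ^ (k + 1) := by
        have : ∑ k ∈ Finset.range N, (legendreCoeff (n + 1) k : ℂ) * ((t - 1) / 2) ^ (k + 1) =
            (t - 1) / 2 *
            ∑ k ∈ Finset.range (N + 1), (legendreCoeff (n + 1) k : ℂ) * ((t - 1) / 2) ^ k := by
          rw [Finset.sum_range_succ _ N, legendreCoeff_eq_zero (by omega),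
            Nat.cast_zero, zero_mul, add_zero, Finset.mul_sum]
          exact Finset.sum_congr rfl fun k _ => by ring
        rw [this]; ring
      rw [ht, Finset.sum_range_succ', Finset.sum_range_succ' _ N, Finset.sum_range_succ' _ N]
      simp only [legendreCoeff_zero_right, mul_add, Finset.mul_sum]
      have : ∀ k ∈ Finset.range N,
          ((n : ℂ) + 2) * ((legendreCoeff (n + 2) (k + 1) : ℂ) * ((t - 1) / 2) ^ (k + 1)) =
          (2 * n + 3) * ((legendreCoeff (n + 1) (k + 1) : ℂ) * ((t - 1) / 2) ^ (k + 1)) +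
          (2 * n + 3) * 2 * ((legendreCoeff (n + 1) k : ℂ) * ((t - 1) / 2) ^ (k + 1)) -
          (n + 1) * ((legendreCoeff n (k + 1) : ℂ) * ((t - 1) / 2) ^ (k + 1)) := by
        intro k _
        have h3 : ((n : ℂ) + 2) * legendreCoeff (n + 2) (k + 1) =
            (2 * n + 3) * (legendreCoeff (n + 1) (k + 1) + 2 * legendreCoeff (n + 1) k) -
            (n + 1) * legendreCoeff n (k + 1) := by exact_mod_cast legendreCoeff_three_term n k
        linear_combination ((t - 1) / 2) ^ (k + 1) * h3
      rw [Finset.sum_congr rfl this, Finset.sum_sub_distrib, Finset.sum_add_distrib]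
      push_cast
      ring
    rw [legendreP]
    simp only [map_mul, map_sub, aeval_C, aeval_X, ih1 (by omega), ih0 (by omega)]
    apply mul_left_cancel₀ hn
    rw [key]
    simp only [eq_ratCast]
    push_cast
    field_simp

/-! ### Divisibility of the coefficients by `p` and `p ^ 2` -/

section PrimeDivisibility

variable {p : ℕ}

theorem sextic_factors_zmod (hp : p.Prime) (hp3 : 3 < p) :
    (6 * ((p / 6 : ℕ) : ZMod p) + 1) * (6 * ((p / 6 : ℕ) : ZMod p) + 5) = 0 := by
  have h2 : ¬ 2 ∣ p := fun h => by
    have := (Nat.prime_dvd_prime_iff_eq Nat.prime_two hp).1 h; omega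
  have h3 : ¬ 3 ∣ p := fun h => by
    have := (Nat.prime_dvd_prime_iff_eq Nat.prime_three hp).1 h; omega
  have : p = 6 * (p / 6) + 1 ∨ p = 6 * (p / 6) + 5 := by omega
  have h0 : ((p : ℕ) : ZMod p) = 0 := ZMod.natCast_self p
  rcases this with h | h
  · have h4 : ((6 * (p / 6) + 1 : ℕ) : ZMod p) = 0 := by rw [← h, h0]
    push_cast at h4
    rw [h4, zero_mul]
  · have h4 : ((6 * (p / 6) + 5 : ℕ) : ZMod p) = 0 := by rw [← h, h0]
    push_cast at h4
    rw [h4, mul_zero]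

theorem natCast_ne_zero_of_lt {k : ℕ} (h0 : 0 < k) (hk : k < p) : (k : ZMod p) ≠ 0 := by
  rw [Ne, ZMod.natCast_eq_zero_iff]
  exact Nat.not_dvd_of_pos_of_lt h0 hk

theorem two_ne_zero_zmod (hp3 : 3 < p) : (2 : ZMod p) ≠ 0 := by
  exact_mod_cast natCast_ne_zero_of_lt (p := p) (k := 2) (by omega) (by omega)

theorem three_ne_zero_zmod (hp3 : 3 < p) : (3 : ZMod p) ≠ 0 := by
  exact_mod_cast natCast_ne_zero_of_lt (p := p) (k := 3) (by omega) (by omega)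

/-- With `n = p / 6`, `36 (n - k) (n + k + 1) = (6n + 1) (6n + 5) - (6k + 1) (6k + 5)`, and the
first product vanishes modulo `p`. -/
theorem legendreCoeff_succ_zmod (hp : p.Prime) (hp3 : 3 < p) (k : ℕ) :
    36 * ((k : ZMod p) + 1) ^ 2 * legendreCoeff (p / 6) (k + 1) =
      -((6 * k + 1) * (6 * k + 5)) * legendreCoeff (p / 6) k := by
  have h := congrArg (Int.cast : ℤ → ZMod p) (legendreCoeff_succ_right (p / 6) k)
  have h0 := sextic_factors_zmod hp hp3
  generalize p / 6 = n at h h0 ⊢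
  push_cast at h
  linear_combination 36 * h + legendreCoeff n k * h0

theorem legendreCoeff_zmod_eq_sexticCoeff (hp : p.Prime) (hp3 : 3 < p) {k : ℕ} (hk : k < p) :
    (legendreCoeff (p / 6) k : ZMod p) * (-432) ^ k = sexticCoeff k := by
  have := Fact.mk hp
  induction k with
  | zero => simp [legendreCoeff, sexticCoeff]
  | succ k ih =>
    have h1 := legendreCoeff_succ_zmod hp hp3 k
    have h2 := congrArg (Nat.cast : ℕ → ZMod p) (sexticCoeff_succ k)
    push_cast at h2
    have hk0 : ((k : ZMod p) + 1) ≠ 0 := by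
      exact_mod_cast natCast_ne_zero_of_lt (by omega : 0 < k + 1) hk
    have h36 : (36 : ZMod p) ≠ 0 := by
      rw [show (36 : ZMod p) = (2 * 3) ^ 2 by norm_num]
      exact pow_ne_zero _ (mul_ne_zero (two_ne_zero_zmod hp3) (three_ne_zero_zmod hp3))
    apply mul_left_cancel₀ (mul_ne_zero h36 (pow_ne_zero 2 hk0))
    rw [pow_succ]
    linear_combination (-432) ^ k * (-432) * h1 - 36 * h2 +
      432 * (6 * k + 1) * (6 * k + 5) * ih (by omega)

theorem dvd_sexticCoeff (hp : p.Prime) (hp3 : 3 < p) {k : ℕ} (hk : p / 6 < k) (hkp : k < p) :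
    p ∣ sexticCoeff k := by
  rw [← ZMod.natCast_eq_zero_iff, ← legendreCoeff_zmod_eq_sexticCoeff hp hp3 hkp,
    legendreCoeff_eq_zero hk]
  simp

/-- One factor `p` is present beyond `p / 6`. The second enters at the step from `j = p - 1 - p /
6`, where `(6j + 1) (6j + 5) ≡ 0`; later steps keep both because `k + 1` stays prime to `p`. -/
theorem sq_dvd_sexticCoeff (hp : p.Prime) (hp3 : 3 < p) {k : ℕ} (hk : p ≤ p / 6 + k)
    (hkp : k < p) : p ^ 2 ∣ sexticCoeff k := by
  have cop : ∀ j, j + 1 < p → Nat.Coprime (p ^ 2) ((j + 1) ^ 2) := fun j hj =>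
    Nat.Coprime.pow _ _ (Nat.coprime_of_lt_prime (by omega) hj hp)
  obtain ⟨d, rfl⟩ : ∃ d, k = p - p / 6 + d := ⟨k - (p - p / 6), by omega⟩
  clear hk
  induction d with
  | zero =>
    obtain ⟨j, hj⟩ : ∃ j, p - p / 6 + 0 = j + 1 := ⟨p - p / 6 - 1, by omega⟩
    rw [hj]
    apply (cop j (by omega)).dvd_of_dvd_mul_left
    rw [sexticCoeff_succ, sq]
    refine mul_dvd_mul ?_ (dvd_sexticCoeff hp hp3 (by omega) (by omega))
    rw [mul_assoc]
    apply Dvd.dvd.mul_left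
    rw [← ZMod.natCast_eq_zero_iff]
    have h0 := sextic_factors_zmod hp hp3
    have h1 : (j : ZMod p) = -1 - ((p / 6 : ℕ) : ZMod p) := by
      have : ((p / 6 + (j + 1) : ℕ) : ZMod p) = 0 := by
        rw [show p / 6 + (j + 1) = p by omega, ZMod.natCast_self]
      push_cast at this
      linear_combination this
    push_cast
    rw [h1]
    linear_combination h0
  | succ d ih =>
    rw [← add_assoc] at hkp ⊢
    apply (cop _ hkp).dvd_of_dvd_mul_left
    rw [sexticCoeff_succ]
    exact Dvd.dvd.mul_left (ih (by omega)) _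

theorem sq_dvd_clausenCoeff (hp : p.Prime) (hp3 : 3 < p) {k : ℕ} (hk : p ≤ 2 * k)
    (hkp : k < p) : p ^ 2 ∣ clausenCoeff k := by
  rw [sq]
  refine mul_dvd_mul ?_ (dvd_sexticCoeff hp hp3 (by omega) hkp)
  exact hp.dvd_choose hkp (by omega) hk

theorem sq_dvd_sexticCoeff_mul (hp : p.Prime) (hp3 : 3 < p) {i j : ℕ} (hi : i < p) (hj : j < p)
    (hij : p ≤ i + j) : p ^ 2 ∣ sexticCoeff i * sexticCoeff j := by
  rcases le_or_gt i (p / 6) with h | h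
  · exact Dvd.dvd.mul_left (sq_dvd_sexticCoeff hp hp3 (by omega) hj) _
  rcases le_or_gt j (p / 6) with h' | h'
  · exact Dvd.dvd.mul_right (sq_dvd_sexticCoeff hp hp3 (by omega) hi) _
  rw [sq]
  exact mul_dvd_mul (dvd_sexticCoeff hp hp3 h hi) (dvd_sexticCoeff hp hp3 h' hj)

end PrimeDivisibility

/-! ### Clausen's formula for truncated series -/

/-- The quadratic polynomial `x (1 - 432 x)` of the change of variable in Clausen's formula. -/
noncomputable def clausenArg : ℤ[X] := X - 432 * X ^ 2

/-- The third order differential operator annihilating the square of `₂F₁(1/6, 5/6; 1; 432 x)`. -/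
noncomputable def clausenOp (D : ℤ[X]) : ℤ[X] :=
  derivative (clausenArg * derivative (clausenArg * derivative D)) -
    240 * clausenArg * derivative D - 120 * derivative clausenArg * D

theorem derivative_clausenArg : derivative clausenArg = 1 - 864 * X := by
  simp [clausenArg, derivative_pow]
  ring

theorem clausenOp_add (D E : ℤ[X]) : clausenOp (D + E) = clausenOp D + clausenOp E := by
  simp only [clausenOp, derivative_add, mul_add]
  ring

theorem clausenOp_sub (D E : ℤ[X]) : clausenOp (D - E) = clausenOp D - clausenOp E := by
  simp only [clausenOp, derivative_sub, mul_sub]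
  ring

theorem clausenOp_C_mul (c : ℤ) (D : ℤ[X]) : clausenOp (C c * D) = C c * clausenOp D := by
  simp only [clausenOp, derivative_C_mul, mul_left_comm clausenArg (C c)]
  ring

theorem derivative_derivative_clausenArg : derivative (derivative clausenArg) = -864 := by
  simp [derivative_clausenArg]

theorem derivative_clausenArg_sq : derivative clausenArg ^ 2 = 1 - 1728 * clausenArg := by
  rw [derivative_clausenArg, clausenArg]
  ring

/-- On polynomials in `u = clausenArg` the operator is `u'` times the hypergeometric operator of
`₃F₂` in `u`, because `u' ^ 2 = 1 - 1728 u`. -/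
theorem clausenOp_pow_succ (k : ℕ) :
    clausenOp (clausenArg ^ (k + 1)) = derivative clausenArg *
      ((k + 1) ^ 3 * clausenArg ^ k -
        24 * (2 * (k + 1) + 1) * (6 * (k + 1) + 1) * (6 * (k + 1) + 5) * clausenArg ^ (k + 1)) := by
  have h1 : clausenArg * derivative (clausenArg ^ (k + 1)) =
      (k + 1) * clausenArg ^ (k + 1) * derivative clausenArg := by
    rw [derivative_pow_succ]
    simp
    ring
  have h2 : clausenArg * derivative (clausenArg * derivative (clausenArg ^ (k + 1))) =
      (k + 1) ^ 2 * clausenArg ^ (k + 1) -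
        (1728 * (k + 1) ^ 2 + 864 * (k + 1)) * clausenArg ^ (k + 2) := by
    rw [h1]
    simp only [derivative_mul, derivative_pow_succ, derivative_derivative_clausenArg]
    simp
    linear_combination (k + 1) ^ 2 * clausenArg ^ (k + 1) * derivative_clausenArg_sq
  unfold clausenOp
  rw [h2, mul_assoc, h1]
  simp only [derivative_sub, derivative_mul, derivative_pow_succ]
  simp [derivative_pow]
  ring

theorem clausenOp_one : clausenOp 1 = -120 * derivative clausenArg := by
  simp [clausenOp]

/-- By `clausenCoeff_succ` the sum telescopes, leaving only the boundary term of the truncation. -/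
theorem clausenOp_sum (N : ℕ) :
    clausenOp (∑ k ∈ Finset.range (N + 1), C (clausenCoeff k : ℤ) * clausenArg ^ k) =
      -(derivative clausenArg * C (((N : ℤ) + 1) ^ 3 * clausenCoeff (N + 1)) *
        clausenArg ^ N) := by
  have h : ∀ k : ℕ, C (((k : ℤ) + 1) ^ 3 * clausenCoeff (k + 1)) =
      24 * (2 * (k : ℤ[X]) + 1) * (6 * (k : ℤ[X]) + 1) * (6 * (k : ℤ[X]) + 5) * C (clausenCoeff k : ℤ) := by
    intro k
    have := congrArg (fun n : ℕ => C (n : ℤ)) (clausenCoeff_succ k)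
    simpa using this
  induction N with
  | zero =>
    rw [h]
    simp [clausenOp_one, clausenCoeff, sexticCoeff]
    ring
  | succ N ih =>
    rw [Finset.sum_range_succ, clausenOp_add, ih, clausenOp_C_mul, clausenOp_pow_succ, h (N + 1)]
    simp only [map_mul, map_pow, map_add, map_natCast, map_one]
    push_cast
    ring

theorem sextic_ode_sum (N : ℕ) :
    derivative (clausenArg *
        derivative (∑ k ∈ Finset.range (N + 1), C (sexticCoeff k : ℤ) * X ^ k)) -
      60 * ∑ k ∈ Finset.range (N + 1), C (sexticCoeff k : ℤ) * X ^ k =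
      -(C (((N : ℤ) + 1) ^ 2 * sexticCoeff (N + 1)) * X ^ N) := by
  have h : ∀ k : ℕ, C (((k : ℤ) + 1) ^ 2 * sexticCoeff (k + 1)) =
      12 * (6 * (k : ℤ[X]) + 1) * (6 * (k : ℤ[X]) + 5) * C (sexticCoeff k : ℤ) := by
    intro k
    have := congrArg (fun n : ℕ => C (n : ℤ)) (sexticCoeff_succ k)
    simpa using this
  induction N with
  | zero =>
    rw [h]
    simp [sexticCoeff]
    norm_num
  | succ N ih =>
    have h3 : derivative (clausenArg * derivative (C (sexticCoeff (N + 1) : ℤ) * X ^ (N + 1))) =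
        C (sexticCoeff (N + 1) : ℤ) *
          (((N : ℤ[X]) + 1) ^ 2 * X ^ N - 432 * ((N : ℤ[X]) + 1) * ((N : ℤ[X]) + 2) * X ^ (N + 1))
        := by
      have : clausenArg * derivative (C (sexticCoeff (N + 1) : ℤ) * X ^ (N + 1)) =
          C (sexticCoeff (N + 1) : ℤ) * ((N : ℤ[X]) + 1) * (X ^ (N + 1) - 432 * X ^ (N + 2)) := by
        simp [clausenArg]
        ring
      rw [this]
      simp [derivative_pow_succ]
      ring
    rw [Finset.sum_range_succ, derivative_add, mul_add, derivative_add, h3, h (N + 1)]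
    simp only [map_mul, map_pow, map_add, map_natCast, map_one] at ih ⊢
    push_cast
    linear_combination ih

/-- `clausenOp` is the symmetric square of the second order operator; `E` carries the truncation
error. -/
theorem clausenOp_sq (F E : ℤ[X])
    (hE : derivative (clausenArg * derivative F) - 60 * F = E) :
    clausenOp (F ^ 2) =
      2 * derivative (F * clausenArg * E) + 4 * clausenArg * derivative F * E := by
  have h1 : clausenArg * derivative (F ^ 2) = 2 * F * (clausenArg * derivative F) := by
    rw [sq, derivative_mul]
    ring
  have h2 : derivative (clausenArg * derivative F) = 60 * F + E := by
    rw [← hE]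
    ring
  have h3 : clausenArg * derivative (clausenArg * derivative (F ^ 2)) =
      2 * (clausenArg * derivative F) ^ 2 + 120 * (clausenArg * F ^ 2) +
        2 * (F * clausenArg * E) := by
    rw [h1, derivative_mul, h2]
    simp
    ring
  have h4 : derivative ((clausenArg * derivative F) ^ 2) =
      2 * (clausenArg * derivative F) * (60 * F + E) := by
    rw [sq, derivative_mul, h2]
    ring
  unfold clausenOp
  rw [h3, derivative_add, derivative_add, derivative_mul (f := 2), derivative_mul (f := 120),
    derivative_mul (f := 2), derivative_ofNat, derivative_ofNat, h4, derivative_mul, mul_assoc 240, h1, sq, derivative_mul]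
  ring

theorem X_pow_dvd_derivative {n : ℕ} {D : ℤ[X]} (h : X ^ (n + 1) ∣ D) : X ^ n ∣ derivative D := by
  obtain ⟨E, rfl⟩ := h
  rw [derivative_mul, derivative_X_pow_succ]
  exact dvd_add (Dvd.intro_left _ (by ring : (C ((n : ℤ) + 1) * E) * X ^ n = _))
    (Dvd.intro (X * derivative E) (by ring))

theorem X_pow_dvd_clausenArg_mul {n : ℕ} {D : ℤ[X]} (h : X ^ n ∣ D) :
    X ^ (n + 1) ∣ clausenArg * D := by
  rw [pow_succ']
  exact mul_dvd_mul ⟨1 - 432 * X, by rw [clausenArg]; ring⟩ h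

theorem X_pow_dvd_clausenOp {n : ℕ} {D : ℤ[X]} (h : X ^ (n + 1) ∣ D) : X ^ n ∣ clausenOp D := by
  have h1 := X_pow_dvd_derivative h
  unfold clausenOp
  refine dvd_sub (dvd_sub ?_ ?_) ?_
  · exact X_pow_dvd_derivative (X_pow_dvd_clausenArg_mul
      (X_pow_dvd_derivative (X_pow_dvd_clausenArg_mul h1)))
  · exact Dvd.dvd.mul_left h1 _
  · exact Dvd.dvd.mul_left (dvd_of_mul_right_dvd (by rwa [pow_succ] at h)) _

/-- The lowest term of `clausenOp (X ^ (n + 1))` is `(n + 1) ^ 3 X ^ n`, with nonzero coefficient,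
so a solution is determined order by order from its constant term. -/
theorem X_pow_dvd_of_dvd_clausenOp {N : ℕ} {D : ℤ[X]} (h0 : X ∣ D) (h : X ^ N ∣ clausenOp D) :
    X ^ (N + 1) ∣ D := by
  suffices H : ∀ n ≤ N, X ^ (n + 1) ∣ D from H N le_rfl
  intro n
  induction n with
  | zero => intro _; simpa using h0
  | succ n ih =>
    intro hn
    obtain ⟨E, hE⟩ := ih (by omega)
    have hsplit : D = C (E.coeff 0) * X ^ (n + 1) + X ^ (n + 2) * E.divX := by
      rw [hE]
      nth_rw 1 [← E.divX_mul_X_add]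
      ring
    have h1 : X ^ (n + 1) ∣ C (E.coeff 0) * clausenOp (X ^ (n + 1)) := by
      rw [← clausenOp_C_mul]
      have h2 : X ^ (n + 1) ∣ clausenOp D := (pow_dvd_pow X hn).trans h
      rw [hsplit, clausenOp_add] at h2
      exact (dvd_add_left (X_pow_dvd_clausenOp (Dvd.intro _ rfl))).1 h2
    have h3 : ∃ R : ℤ[X], clausenOp (X ^ (n + 1)) = C (((n : ℤ) + 1) ^ 3) * X ^ n +
        X ^ (n + 1) * R := by
      have e1 : clausenArg * derivative (X ^ (n + 1)) =
          ((n : ℤ[X]) + 1) * (X ^ (n + 1) - 432 * X ^ (n + 2)) := by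
        simp [clausenArg]
        ring
      have e2 : clausenArg * derivative (clausenArg * derivative (X ^ (n + 1))) =
          ((n : ℤ[X]) + 1) ^ 2 * X ^ (n + 1) - 432 * ((n : ℤ[X]) + 1) * (2 * (n : ℤ[X]) + 3) * X ^ (n + 2) +
            432 ^ 2 * ((n : ℤ[X]) + 1) * ((n : ℤ[X]) + 2) * X ^ (n + 3) := by
        rw [e1]
        simp [clausenArg, derivative_pow_succ]
        ring
      unfold clausenOp
      rw [e2, mul_assoc 240, e1, derivative_clausenArg]
      refine ⟨-432 * ((n : ℤ[X]) + 1) * (2 * (n : ℤ[X]) + 3) * ((n : ℤ[X]) + 2) +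
        432 ^ 2 * ((n : ℤ[X]) + 1) * ((n : ℤ[X]) + 2) * ((n : ℤ[X]) + 3) * X -
        240 * ((n : ℤ[X]) + 1) * (1 - 432 * X) -
        120 * (1 - 864 * X), ?_⟩
      simp [derivative_pow_succ]
      ring
    obtain ⟨R, hR⟩ := h3
    rw [hR, mul_add, ← mul_assoc, ← C_mul] at h1
    have h4 := (dvd_add_left (Dvd.dvd.mul_left (Dvd.intro R rfl) _)).1 h1
    rw [X_pow_dvd_iff] at h4
    have h5 := h4 n (by omega)
    rw [coeff_C_mul, coeff_X_pow_self, mul_one] at h5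
    have h6 : E.coeff 0 = 0 := by
      rcases mul_eq_zero.1 h5 with h | h
      · exact h
      · exact absurd h (by positivity)
    rw [hsplit, h6, C_0, zero_mul, zero_add]
    exact Dvd.intro _ rfl

theorem X_pow_dvd_clausen_sub (N : ℕ) :
    X ^ (N + 1) ∣ (∑ k ∈ Finset.range (N + 1), C (sexticCoeff k : ℤ) * X ^ k) ^ 2 -
      ∑ k ∈ Finset.range (N + 1), C (clausenCoeff k : ℤ) * clausenArg ^ k := by
  apply X_pow_dvd_of_dvd_clausenOp
  · rw [X_dvd_iff, coeff_zero_eq_eval_zero]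
    simp [Finset.sum_range_succ', eval_finsetSum, clausenArg, clausenCoeff, sexticCoeff]
  · rw [clausenOp_sub, clausenOp_sum, clausenOp_sq _ _ (sextic_ode_sum N)]
    have hE : X ^ N ∣ -(C (((N : ℤ) + 1) ^ 2 * sexticCoeff (N + 1)) * X ^ N) :=
      (Dvd.intro_left _ rfl).neg_right
    refine dvd_sub (dvd_add ?_ (Dvd.dvd.mul_left hE _)) ?_
    · apply Dvd.dvd.mul_left
      apply X_pow_dvd_derivative
      rw [mul_comm _ clausenArg, mul_assoc]
      exact X_pow_dvd_clausenArg_mul (Dvd.dvd.mul_left hE _)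
    · refine Dvd.dvd.neg_right (Dvd.dvd.mul_left (pow_dvd_pow_of_dvd ?_ N) _)
      exact ⟨1 - 432 * X, by rw [clausenArg]; ring⟩

/-- In degree at least `p`, a term of the square has `j + k ≥ p`, and a power `clausenArg ^ k`
contributes only if `2 k ≥ p`; both cases carry `p ^ 2`. -/
theorem clausen_sub_dvd {p : ℕ} (hp : p.Prime) (hp3 : 3 < p) :
    C ((p : ℤ) ^ 2) ∣ (∑ k ∈ Finset.range p, C (sexticCoeff k : ℤ) * X ^ k) ^ 2 -
      ∑ k ∈ Finset.range p, C (clausenCoeff k : ℤ) * clausenArg ^ k := by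
  rw [C_dvd_iff_dvd_coeff]
  intro i
  rcases lt_or_ge i p with hi | hi
  · obtain ⟨N, rfl⟩ : ∃ N, p = N + 1 := ⟨p - 1, by omega⟩
    rw [X_pow_dvd_iff.1 (X_pow_dvd_clausen_sub N) i hi]
    exact dvd_zero _
  rw [coeff_sub]
  apply dvd_sub
  · rw [sq (Finset.sum _ _), Finset.sum_mul_sum, finsetSum_coeff]
    refine Finset.dvd_sum fun j hj => ?_
    rw [finsetSum_coeff]
    refine Finset.dvd_sum fun k hk => ?_
    rw [show C (sexticCoeff j : ℤ) * X ^ j * (C (sexticCoeff k : ℤ) * X ^ k) =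
      C ((sexticCoeff j * sexticCoeff k : ℕ) : ℤ) * X ^ (j + k) by push_cast; rw [C_mul]; ring,
      coeff_C_mul, coeff_X_pow]
    split_ifs with h
    · rw [mul_one]
      exact_mod_cast sq_dvd_sexticCoeff_mul hp hp3 (Finset.mem_range.1 hj)
        (Finset.mem_range.1 hk) (by omega)
    · simp
  · rw [finsetSum_coeff]
    refine Finset.dvd_sum fun k hk => ?_
    rw [coeff_C_mul]
    rcases le_or_gt p (2 * k) with h | h
    · apply Dvd.dvd.mul_right
      exact_mod_cast sq_dvd_clausenCoeff hp hp3 h (Finset.mem_range.1 hk)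
    · rw [coeff_eq_zero_of_natDegree_lt]
      · simp
      · refine lt_of_le_of_lt natDegree_pow_le ?_
        have : clausenArg.natDegree ≤ 2 := by
          rw [clausenArg]
          compute_degree
        nlinarith

/-! ### The cubic character sum modulo `p` -/

section CubicSum

variable {p : ℕ}

theorem sum_zmod_pow [Fact p.Prime] {e : ℕ} (he : e < 2 * (p - 1)) :
    ∑ x : ZMod p, x ^ e = if e = p - 1 then -1 else 0 := by
  have hlt : ∀ i < p - 1, ∑ x : ZMod p, x ^ i = 0 := fun i hi =>
    FiniteField.sum_pow_lt_card_sub_one (ZMod p) i (by rwa [ZMod.card])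
  have hp1 := (Fact.out : p.Prime).one_lt
  split_ifs with h
  · subst h
    rw [← Finset.sum_erase_add _ _ (Finset.mem_univ (0 : ZMod p)), zero_pow (by omega), add_zero,
      Finset.sum_congr rfl fun x hx => ZMod.pow_card_sub_one_eq_one (Finset.ne_of_mem_erase hx),
      Finset.sum_const, Finset.card_erase_of_mem (Finset.mem_univ _), Finset.card_univ, ZMod.card,
      nsmul_eq_mul, Nat.cast_sub hp1.le]
    simp
  · rcases lt_or_gt_of_ne h with h | h
    · exact hlt e h
    · rw [← hlt (e - (p - 1)) (by omega)]
      refine Finset.sum_congr rfl fun x _ => ?_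
      obtain ⟨d, rfl⟩ : ∃ d, e = d + p := ⟨e - p, by omega⟩
      rw [pow_add, ZMod.pow_card, ← pow_succ]
      congr 1
      omega

theorem sum_zmod_pow_mul_add_pow [Fact p.Prime] (hp3 : 3 < p) {k : ℕ} (hk : k ≤ (p - 1) / 2) :
    ∑ x : ZMod p, x ^ (2 * ((p - 1) / 2 - k)) * (x + 3) ^ ((p - 1) / 2 - k) =
      -(((p - 1) / 2 - k).choose (2 * k) * 3 ^ ((p - 1) / 2 - k - 2 * k)) := by
  have hodd : 2 * ((p - 1) / 2) = p - 1 := by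
    have := (Fact.out : p.Prime).eq_two_or_odd
    omega
  set q := (p - 1) / 2 with hq
  have h1 : ∀ x : ZMod p, x ^ (2 * (q - k)) * (x + 3) ^ (q - k) =
      ∑ j ∈ Finset.range (q - k + 1),
        x ^ (2 * (q - k) + j) * (3 ^ (q - k - j) * ((q - k).choose j : ZMod p)) := by
    intro x
    rw [add_pow, Finset.mul_sum]
    exact Finset.sum_congr rfl fun j _ => by ring
  simp only [h1]
  rw [Finset.sum_comm]
  have h2 : ∀ j ∈ Finset.range (q - k + 1),
      ∑ x : ZMod p, x ^ (2 * (q - k) + j) * (3 ^ (q - k - j) * ((q - k).choose j : ZMod p)) =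
      if j = 2 * k then -(((q - k).choose (2 * k) : ZMod p) * 3 ^ (q - k - 2 * k)) else 0 := by
    intro j hj
    rw [Finset.mem_range] at hj
    -- The exponent is at most `3 q < 2 (p - 1)`, and it equals `p - 1 = 2 q` exactly when `j = 2
    -- k`.
    rw [← Finset.sum_mul, sum_zmod_pow (by omega)]
    by_cases h : j = 2 * k
    · rw [if_pos (by omega), if_pos h, h]
      ring
    · rw [if_neg (by omega), if_neg h, zero_mul]
  rw [Finset.sum_congr rfl h2, Finset.sum_ite_eq']
  split_ifs with h
  · rfl
  · rw [Finset.mem_range, not_lt] at h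
    rw [Nat.choose_eq_zero_of_lt (by omega)]
    simp

theorem sum_range_eq_sum_zmod [NeZero p] {R : Type*} [AddCommMonoid R] (f : ZMod p → R) :
    ∑ x ∈ Finset.range p, f x = ∑ x : ZMod p, f x := by
  refine Finset.sum_bij' (fun x _ => (x : ZMod p)) (fun x _ => x.val) ?_ ?_ ?_ ?_ ?_
  · intros; exact Finset.mem_univ _
  · intro x _; exact Finset.mem_range.2 (ZMod.val_lt x)
  · intro x hx; exact ZMod.val_cast_of_lt (Finset.mem_range.1 hx)
  · intro x _; exact ZMod.natCast_zmod_val x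
  · intros; rfl

theorem sum_cubic_pow [Fact p.Prime] (hp3 : 3 < p) {R : Type*} [CommRing R] [Algebra (ZMod p) R]
    (y : R) :
    ∑ x ∈ Finset.range p, ((x : R) ^ 3 - 3 * x + 2 * (1 + 2 * y)) ^ ((p - 1) / 2) =
      -∑ k ∈ Finset.range ((p - 1) / 2 + 1),
        algebraMap (ZMod p) R (((p - 1) / 2).choose k * ((p - 1) / 2 - k).choose (2 * k) *
          3 ^ ((p - 1) / 2 - k - 2 * k) * 4 ^ k) * y ^ k := by
  set q := (p - 1) / 2 with hq
  have h1 := sum_range_eq_sum_zmod (p := p) fun x =>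
    ((algebraMap (ZMod p) R x) ^ 3 - 3 * algebraMap (ZMod p) R x + 2 * (1 + 2 * y)) ^ q
  simp only [map_natCast] at h1
  -- The shift `x ↦ x + 1` turns the cubic into `x ^ 2 (x + 3) + 4 y`.
  rw [h1, ← Equiv.sum_comp (Equiv.addRight (1 : ZMod p))]
  have h2 : ∀ x : ZMod p, ((algebraMap (ZMod p) R (Equiv.addRight (1 : ZMod p) x)) ^ 3 -
      3 * algebraMap (ZMod p) R (Equiv.addRight (1 : ZMod p) x) + 2 * (1 + 2 * y)) ^ q =
      ∑ k ∈ Finset.range (q + 1), algebraMap (ZMod p) R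
        (x ^ (2 * (q - k)) * (x + 3) ^ (q - k)) * ((q.choose k : R) * 4 ^ k * y ^ k) := by
    intro x
    rw [show (algebraMap (ZMod p) R (Equiv.addRight (1 : ZMod p) x)) ^ 3 -
      3 * algebraMap (ZMod p) R (Equiv.addRight (1 : ZMod p) x) + 2 * (1 + 2 * y) =
      4 * y + algebraMap (ZMod p) R (x ^ 2 * (x + 3)) by
        have h3 : algebraMap (ZMod p) R 3 = 3 := map_ofNat _ 3
        simp [h3]
        ring, add_pow]
    refine Finset.sum_congr rfl fun k _ => ?_
    rw [pow_mul, ← mul_pow, map_pow]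
    ring
  rw [Finset.sum_congr rfl fun x _ => h2 x, Finset.sum_comm, ← Finset.sum_neg_distrib]
  refine Finset.sum_congr rfl fun k hk => ?_
  rw [← Finset.sum_mul, ← map_sum,
    sum_zmod_pow_mul_add_pow hp3 (Nat.lt_succ_iff.1 (Finset.mem_range.1 hk))]
  simp only [map_mul, map_neg, map_natCast, map_pow, map_ofNat]
  ring

theorem choose_mul_choose_succ (q k : ℕ) :
    ((k : ℤ) + 1) * (2 * k + 1) * (2 * k + 2) *
      (q.choose (k + 1) * (q - (k + 1)).choose (2 * (k + 1)) : ℕ) =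
      (q - 3 * k) * (q - 3 * k - 1) * (q - 3 * k - 2) *
        (q.choose k * (q - k).choose (2 * k) : ℕ) := by
  have hmul : ∀ j, q.choose j * (q - j).choose (2 * j) = q.choose (3 * j) * (3 * j).choose j := by
    intro j
    rw [Nat.choose_mul (show j ≤ 3 * j by omega), show 3 * j - j = 2 * j by omega]
  rw [hmul, hmul]
  have h : ∀ j : ℕ, ((q.choose (j + 1) : ℤ)) * (j + 1) = q.choose j * (q - j) := by
    intro j
    rcases le_or_gt j q with h | h
    · have := Nat.choose_succ_right_eq q j
      zify [h] at this
      exact this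
    · rw [Nat.choose_eq_zero_of_lt h, Nat.choose_eq_zero_of_lt (by omega)]
      simp
  have h0 := h (3 * k)
  have h1 := h (3 * k + 1)
  have h2 := h (3 * k + 2)
  have hc : ((k : ℤ) + 1) * (2 * k + 1) * (2 * k + 2) * (3 * (k + 1)).choose (k + 1) =
      (3 * k + 1) * (3 * k + 2) * (3 * k + 3) * (3 * k).choose k := by
    have e1 := Nat.choose_mul_factorial_mul_factorial (show k ≤ 3 * k by omega)
    have e2 := Nat.choose_mul_factorial_mul_factorial (show k + 1 ≤ 3 * (k + 1) by omega)
    rw [show 3 * k - k = 2 * k by omega] at e1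
    rw [show 3 * (k + 1) - (k + 1) = 2 * k + 1 + 1 by omega] at e2
    nth_rw 2 [show 3 * (k + 1) = 3 * k + 1 + 1 + 1 by ring] at e2
    simp only [Nat.factorial_succ] at e2
    rw [← e1] at e2
    have hpos : (0 : ℤ) < k.factorial * (2 * k).factorial := by positivity
    apply mul_right_cancel₀ hpos.ne'
    zify at e2
    linear_combination e2
  rw [show 3 * (k + 1) = 3 * k + 2 + 1 by ring] at hc ⊢
  have hk : ((3 : ℤ) * k + 1) * (3 * k + 2) * (3 * k + 3) ≠ 0 := by positivity
  apply mul_left_cancel₀ hk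
  push_cast at *
  linear_combination (q.choose (3 * k + 2 + 1) : ℤ) * (3 * k + 1) * (3 * k + 2) * (3 * k + 3) * hc +
    ((3 * k).choose k : ℤ) * (3 * k + 1) * (3 * k + 2) * (3 * k + 3) *
      ((3 * k + 1) * (3 * k + 2) * h2 + (3 * k + 1) * (q - (3 * k + 2)) * h1 +
        (q - (3 * k + 2)) * (q - (3 * k + 1)) * h0)

/-- Both sides vanish when `3 k > (p - 1) / 2`. Otherwise the ratios of successive terms agree: `(p
- 1) / 2 ≡ -1/2`, and the resulting factor `6k + 3` cancels against `2k + 1`. -/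
theorem legendreCoeff_zmod_eq_choose (hp : p.Prime) (hp3 : 3 < p) {k : ℕ}
    (hk : k ≤ (p - 1) / 2) :
    (legendreCoeff (p / 6) k : ZMod p) * 27 ^ k =
      4 ^ k * (((p - 1) / 2).choose k * ((p - 1) / 2 - k).choose (2 * k) : ℕ) := by
  have := Fact.mk hp
  have hodd : 2 * ((p - 1) / 2) + 1 = p := by
    have := hp.eq_two_or_odd
    omega
  have h3 : ¬ 3 ∣ p := fun h => by
    have := (Nat.prime_dvd_prime_iff_eq Nat.prime_three hp).1 h; omega
  rcases lt_or_ge ((p - 1) / 2) (3 * k) with h | h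
  · rw [legendreCoeff_eq_zero (by omega), Nat.choose_eq_zero_of_lt (by omega : _ < 2 * k)]
    simp
  clear hk
  induction k with
  | zero => simp [legendreCoeff]
  | succ k ih =>
    have h1 := legendreCoeff_succ_zmod hp hp3 k
    have h2 := congrArg (Int.cast : ℤ → ZMod p) (choose_mul_choose_succ ((p - 1) / 2) k)
    have hq : 2 * (((p - 1) / 2 : ℕ) : ZMod p) + 1 = 0 := by
      exact_mod_cast (congrArg (Nat.cast : ℕ → ZMod p) hodd).trans (ZMod.natCast_self p)
    have ih := ih (by omega)
    simp only [Int.cast_mul, Int.cast_sub, Int.cast_add, Int.cast_natCast, Int.cast_ofNat,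
      Int.cast_one] at h2
    have hk1 : ((k : ZMod p) + 1) ≠ 0 := by
      exact_mod_cast natCast_ne_zero_of_lt (p := p) (by omega : 0 < k + 1) (by omega)
    have hk2 : (2 * (k : ZMod p) + 1) ≠ 0 := by
      exact_mod_cast natCast_ne_zero_of_lt (p := p) (by omega : 0 < 2 * k + 1) (by omega)
    generalize ((((p - 1) / 2).choose (k + 1) * ((p - 1) / 2 - (k + 1)).choose (2 * (k + 1)) : ℕ) :
      ZMod p) = s' at h2 ⊢
    generalize ((((p - 1) / 2).choose k * ((p - 1) / 2 - k).choose (2 * k) : ℕ) :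
      ZMod p) = s at h2 ih
    generalize (((p - 1) / 2 : ℕ) : ZMod p) = q at h2 hq
    have h4 : 8 * ((q - 3 * k) * (q - 3 * k - 1) * (q - 3 * k - 2)) =
        -((6 * (k : ZMod p) + 1) * (6 * k + 3) * (6 * k + 5)) := by
      have e0 : 2 * (q - 3 * k) = -(6 * k + 1) := by linear_combination hq
      have e1 : 2 * (q - 3 * k - 1) = -(6 * k + 3) := by linear_combination hq
      have e2 : 2 * (q - 3 * k - 2) = -(6 * k + 5) := by linear_combination hq
      calc _ = 2 * (q - 3 * k) * (2 * (q - 3 * k - 1)) * (2 * (q - 3 * k - 2)) := by ring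
        _ = _ := by rw [e0, e1, e2]; ring
    have h5 : 16 * ((k : ZMod p) + 1) ^ 2 * s' = -(3 * (6 * k + 1) * (6 * k + 5)) * s := by
      apply mul_left_cancel₀ hk2
      linear_combination 8 * h2 + s * h4
    have h36 : (36 : ZMod p) ≠ 0 := by
      rw [show (36 : ZMod p) = (2 * 3) ^ 2 by norm_num]
      exact pow_ne_zero _ (mul_ne_zero (two_ne_zero_zmod hp3) (three_ne_zero_zmod hp3))
    apply mul_left_cancel₀ (mul_ne_zero h36 (pow_ne_zero 2 hk1))
    rw [pow_succ, pow_succ 4]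
    linear_combination 27 ^ k * 27 * h1 - 9 * 4 ^ k * h5 -
      27 * (6 * k + 1) * (6 * k + 5) * ih

theorem legendre_eq_sum_cubic_pow (hp : p.Prime) (hp3 : 3 < p) {R : Type*} [CommRing R]
    [Algebra (ZMod p) R] (y : R) :
    ∑ k ∈ Finset.range p, (legendreCoeff (p / 6) k : R) * y ^ k =
      -3 ^ ((p - 1) / 2) *
        ∑ x ∈ Finset.range p, ((x : R) ^ 3 - 3 * x + 2 * (1 + 2 * y)) ^ ((p - 1) / 2) := by
  have := Fact.mk hp
  have hodd : 2 * ((p - 1) / 2) + 1 = p := by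
    have := hp.eq_two_or_odd
    omega
  have h3q : (3 : ZMod p) ^ (2 * ((p - 1) / 2)) = 1 := by
    rw [show 2 * ((p - 1) / 2) = p - 1 by omega]
    exact ZMod.pow_card_sub_one_eq_one (three_ne_zero_zmod hp3)
  rw [sum_cubic_pow hp3, neg_mul_neg, Finset.mul_sum]
  symm
  refine Finset.sum_subset_zero_on_sdiff (Finset.range_subset_range.2 (by omega)) ?_ ?_
  · intro k hk
    rw [Finset.mem_sdiff, Finset.mem_range, Finset.mem_range] at hk
    rw [legendreCoeff_eq_zero (by omega)]
    simp
  · intro k hk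
    have hk : k ≤ (p - 1) / 2 := Nat.lt_succ_iff.1 (Finset.mem_range.1 hk)
    have h := legendreCoeff_zmod_eq_choose hp hp3 hk
    have h27 : (27 : ZMod p) ^ k ≠ 0 := by
      rw [show (27 : ZMod p) = 3 ^ 3 by norm_num]
      exact pow_ne_zero _ (pow_ne_zero _ (three_ne_zero_zmod hp3))
    have key : (3 : ZMod p) ^ ((p - 1) / 2) * (((p - 1) / 2).choose k *
        ((p - 1) / 2 - k).choose (2 * k) * 3 ^ ((p - 1) / 2 - k - 2 * k) * 4 ^ k) =
        legendreCoeff (p / 6) k := by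
      apply mul_left_cancel₀ h27
      rw [mul_comm _ (legendreCoeff _ _ : ZMod p), h, Nat.cast_mul]
      rcases lt_or_ge ((p - 1) / 2) (3 * k) with h' | h'
      · rw [Nat.choose_eq_zero_of_lt (by omega : (p - 1) / 2 - k < 2 * k)]
        simp
      -- The powers of 3 collect to `3 ^ (p - 1)`.
      · have e : (27 : ZMod p) ^ k * (3 ^ ((p - 1) / 2) * 3 ^ ((p - 1) / 2 - k - 2 * k)) = 1 := by
          rw [show (27 : ZMod p) = 3 ^ 3 by norm_num, ← pow_mul, ← pow_add, ← pow_add, ← h3q]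
          congr 1
          omega
        linear_combination (4 : ZMod p) ^ k * ((p - 1) / 2).choose k *
          ((p - 1) / 2 - k).choose (2 * k) * e
    rw [← map_natCast (algebraMap (ZMod p) R), ← key]
    simp only [map_mul, map_natCast, map_pow, map_ofNat]
    ring

end CubicSum

/-! ### Integrality over `R_p` -/

section Integrality

variable {p : ℕ}

theorem mem_Rp_iff_padicValuation [Fact p.Prime] {q : ℚ} :
    q ∈ Rp p ↔ q ∈ (Rat.padicValuation p).integer := by
  rw [Valuation.mem_integer_iff, Rat.padicValuation_le_one_iff,
    ← Nat.Prime.coprime_iff_not_dvd Fact.out, Nat.coprime_comm]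
  rfl

/-- `R_p` is the valuation ring of the `p`-adic valuation on `ℚ`, hence integrally closed. -/
theorem mem_Rp_of_isIntegral [Fact p.Prime] {q : ℚ} (h : IsIntegral (Rp p) q) : q ∈ Rp p := by
  rw [mem_Rp_iff_padicValuation]
  refine (Valuation.integer.integers (Rat.padicValuation p)).mem_of_integral ?_
  exact h.map_of_comp_eq
    (Subring.inclusion (fun x hx => mem_Rp_iff_padicValuation.1 hx) :
      Rp p →+* (Rat.padicValuation p).integer) (RingHom.id ℚ) rfl

theorem natCast_inv_mem_Rp {n : ℕ} (h : n.Coprime p) : (n : ℚ)⁻¹ ∈ Rp p := by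
  change Nat.Coprime ((n : ℚ)⁻¹).den p
  rw [Rat.inv_natCast_den]
  split_ifs with h0
  · simp
  · exact h

theorem inv_mem_Rp (hp : p.Prime) {m : ℚ} (hm : m ∈ Rp p) (hm0 : ¬ RatCongr p p m 0) :
    m⁻¹ ∈ Rp p := by
  have hnum : m.num.natAbs.Coprime p := by
    rw [Nat.coprime_comm, Nat.Prime.coprime_iff_not_dvd hp]
    intro hd
    obtain ⟨c, hc⟩ := Int.natCast_dvd.2 hd
    refine hm0 ⟨c * (m.den : ℚ)⁻¹, mul_mem (intCast_mem _ c) (natCast_inv_mem_Rp hm), ?_⟩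
    rw [sub_zero, ← mul_assoc]
    nth_rw 1 [← Rat.num_div_den m, hc]
    push_cast
    rw [div_eq_mul_inv]
  have hinv : (m.num : ℚ)⁻¹ ∈ Rp p := by
    rcases Int.natAbs_eq m.num with h | h
    · rw [h, Int.cast_natCast]
      exact natCast_inv_mem_Rp hnum
    · rw [h, Int.cast_neg, Int.cast_natCast, inv_neg]
      exact neg_mem (natCast_inv_mem_Rp hnum)
  rw [← Rat.num_div_den m, inv_div, div_eq_mul_inv]
  exact mul_mem (natCast_mem _ _) hinv

theorem isIntegral_ratCast {q : ℚ} (hq : q ∈ Rp p) : IsIntegral (Rp p) (q : ℂ) :=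
  isIntegral_algebraMap (R := Rp p) (A := ℂ) (x := ⟨q, hq⟩)

theorem mem_Rp_of_isIntegral_ratCast [Fact p.Prime] {q : ℚ} (h : IsIntegral (Rp p) (q : ℂ)) :
    q ∈ Rp p :=
  mem_Rp_of_isIntegral ((isIntegral_algebraMap_iff (algebraMap ℚ ℂ).injective).1 h)

theorem IsIntegral.aeval_int {R B : Type*} [CommRing R] [CommRing B] [Algebra R B] {x : B}
    (hx : IsIntegral R x) (E : ℤ[X]) : IsIntegral R (aeval x E) := by
  rw [aeval_eq_sum_range]
  exact IsIntegral.sum _ fun i _ => by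
    rw [zsmul_eq_mul]
    exact (isIntegral_intCast _).mul (hx.pow i)

end Integrality

/-! ### Evaluation at algebraic numbers and conclusion -/

theorem binomSum_eq (p : ℕ) (m : ℚ) (u : ℚ) (hu : u = m⁻¹) :
    binomSum p m = ∑ k ∈ Finset.range p, (clausenCoeff k : ℚ) * u ^ k := by
  subst hu
  refine Finset.sum_congr rfl fun k _ => ?_
  rw [inv_pow, div_eq_mul_inv, clausenCoeff, sexticCoeff, mul_assoc]

theorem C_dvd_of_map_zmod_eq_zero {p : ℕ} {W : ℤ[X]} (h : W.map (Int.castRingHom (ZMod p)) = 0) :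
    C (p : ℤ) ∣ W := by
  rw [C_dvd_iff_dvd_coeff]
  intro i
  have := congrArg (fun P => coeff P i) h
  rw [← ZMod.intCast_zmod_eq_zero_iff_dvd]
  simpa [coeff_map] using this

/-- `P_[p/6] + 3^((p-1)/2) S` in terms of `y = (t - 1) / 2`, where `S` is the cubic sum. -/
noncomputable def legendreAddCubic (p : ℕ) : ℤ[X] :=
  ∑ k ∈ Finset.range p, (legendreCoeff (p / 6) k : ℤ[X]) * X ^ k +
    3 ^ ((p - 1) / 2) *
      ∑ x ∈ Finset.range p, ((x : ℤ[X]) ^ 3 - 3 * (x : ℤ[X]) + 2 * (1 + 2 * X)) ^ ((p - 1) / 2)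

/-- Working with an indeterminate over `ZMod p` gives divisibility in `ℤ[X]`, so the quotient takes
integral values at integral `y`. -/
theorem C_dvd_legendreAddCubic {p : ℕ} (hp : p.Prime) (hp3 : 3 < p) :
    C (p : ℤ) ∣ legendreAddCubic p := by
  apply C_dvd_of_map_zmod_eq_zero
  have h := legendre_eq_sum_cubic_pow hp hp3 (X : (ZMod p)[X])
  simp only [legendreAddCubic, Polynomial.map_add, Polynomial.map_mul, Polynomial.map_sum,
    Polynomial.map_pow, Polynomial.map_sub, Polynomial.map_natCast, Polynomial.map_ofNat, map_X,
    Polynomial.map_one]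
  rw [h]
  ring

theorem theorem4p1 (p : ℕ) (hp : p.Prime) (hp3 : 3 < p)
    (m : ℚ) (hm : m ∈ Rp p) (hm0 : ¬ RatCongr p p m 0)
    (t : ℂ) (ht : t ^ 2 = 1 - 1728 / (m : ℂ)) :
    AlgCongr p p (binomSum p m : ℂ) (aeval t (legendreP (p / 6)) ^ 2) ∧
    AlgCongr p p (aeval t (legendreP (p / 6)) ^ 2) (cubicSum p t ^ 2) ∧
    (AlgCongr p p (aeval t (legendreP (p / 6))) 0 ∨ AlgCongr p p (cubicSum p t) 0 →
      RatCongr p (p ^ 2) (binomSum p m) 0) := by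
  have := Fact.mk hp
  have hpC : (p : ℂ) ≠ 0 := Nat.cast_ne_zero.2 hp.ne_zero
  have hint : ∀ n : ℕ, IsIntegral (Rp p) (n : ℂ) := fun n => by
    simpa using isIntegral_ratCast (natCast_mem (Rp p) n)
  have hmC : (m : ℂ) ≠ 0 := by
    rintro h
    apply hm0
    rw [Rat.cast_eq_zero] at h
    exact ⟨0, zero_mem _, by simp [h]⟩
  -- Integrality of `t` and of the auxiliary variables.
  have ht_int : IsIntegral (Rp p) t := by
    apply IsIntegral.of_pow (n := 2) (by norm_num)
    rw [ht]
    have := isIntegral_ratCast (sub_mem (one_mem (Rp p))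
      (mul_mem (natCast_mem _ 1728) (inv_mem_Rp hp hm hm0)))
    simpa [div_eq_mul_inv] using this
  have h864 : IsIntegral (Rp p) ((864 : ℂ)⁻¹) := by
    have h2 : Nat.Coprime 2 p := (Nat.coprime_primes Nat.prime_two hp).2 (by omega)
    have h3 : Nat.Coprime 3 p := (Nat.coprime_primes Nat.prime_three hp).2 (by omega)
    have : Nat.Coprime 864 p := by
      rw [show 864 = 2 ^ 5 * 3 ^ 3 by norm_num]
      exact (h2.pow_left 5).mul_left (h3.pow_left 3)
    simpa using isIntegral_ratCast (natCast_inv_mem_Rp this)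
  -- A root of `x (1 - 432 x) = 1 / m`, chosen so that `-432 x = (t - 1) / 2`.
  obtain ⟨x, hx⟩ : ∃ x : ℂ, x = (1 - t) * 864⁻¹ := ⟨_, rfl⟩
  have hx_int : IsIntegral (Rp p) x := hx ▸ (isIntegral_one.sub ht_int).mul h864
  obtain ⟨y, hy⟩ : ∃ y : ℂ, y = -432 * x := ⟨_, rfl⟩
  have hy' : (t - 1) / 2 = y := by rw [hy, hx]; ring
  have hty : t = 1 + 2 * y := by rw [← hy']; ring
  have hy_int : IsIntegral (Rp p) y := by
    rw [hy]
    simpa using ((hint 432).neg).mul hx_int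
  have hux : aeval x clausenArg = ((m⁻¹ : ℚ) : ℂ) := by
    have : (m : ℂ)⁻¹ = (1 - t ^ 2) / 1728 := by rw [ht]; field_simp; ring
    have h432 : aeval x (432 : ℤ[X]) = 432 := map_ofNat _ 432
    rw [Rat.cast_inv, this, clausenArg, map_sub, map_mul, map_pow, aeval_X, h432, hx]
    ring
  obtain ⟨P, hP⟩ : ∃ P : ℂ, P = aeval t (legendreP (p / 6)) := ⟨_, rfl⟩
  obtain ⟨S, hS⟩ : ∃ S : ℂ, S = cubicSum p t := ⟨_, rfl⟩
  have hP' : P = ∑ k ∈ Finset.range p, (legendreCoeff (p / 6) k : ℂ) * y ^ k := by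
    rw [hP, aeval_legendreP t _ p (by omega), hy']
  have hP_int : IsIntegral (Rp p) P := by
    rw [hP']
    exact IsIntegral.sum _ fun k _ => (hint _).mul (hy_int.pow k)
  have hS_int : IsIntegral (Rp p) S := by
    rw [hS]
    refine IsIntegral.sum _ fun k _ => IsIntegral.pow (((hint k).pow 3).sub ?_ |>.add ?_) _
    · exact_mod_cast (hint 3).mul (hint k)
    · exact_mod_cast (hint 2).mul ht_int
  obtain ⟨F, hF⟩ : ∃ F : ℂ, F = ∑ k ∈ Finset.range p, (sexticCoeff k : ℂ) * x ^ k := ⟨_, rfl⟩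
  obtain ⟨e₁, he₁, h1⟩ : ∃ e : ℂ, IsIntegral (Rp p) e ∧
      F ^ 2 - (binomSum p m : ℂ) = (p : ℂ) ^ 2 * e := by
    obtain ⟨E, hE⟩ := clausen_sub_dvd hp hp3
    refine ⟨aeval x E, hx_int.aeval_int E, ?_⟩
    have := congrArg (aeval x) hE
    simp only [map_sub, map_pow, map_sum, map_mul, aeval_X, map_natCast, hux] at this
    rw [← this, hF, binomSum_eq p m _ rfl]
    push_cast
    rfl
  obtain ⟨e₂, he₂, h2⟩ : ∃ e : ℂ, IsIntegral (Rp p) e ∧ F = P + p * e := by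
    have hd : ∀ k ∈ Finset.range p, ∃ d : ℤ,
        (sexticCoeff k : ℤ) - legendreCoeff (p / 6) k * (-432) ^ k = p * d := by
      intro k hk
      refine (ZMod.intCast_zmod_eq_zero_iff_dvd ..).1 ?_
      have := legendreCoeff_zmod_eq_sexticCoeff hp hp3 (Finset.mem_range.1 hk)
      push_cast
      rw [this, sub_self]
    choose! d hd using hd
    refine ⟨∑ k ∈ Finset.range p, (d k : ℂ) * x ^ k, IsIntegral.sum _ fun k _ =>
      (isIntegral_intCast _).mul (hx_int.pow k), ?_⟩
    rw [hF, hP', Finset.mul_sum, ← Finset.sum_add_distrib]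
    refine Finset.sum_congr rfl fun k hk => ?_
    have := congrArg (Int.cast : ℤ → ℂ) (hd k hk)
    push_cast at this
    rw [hy, mul_pow]
    linear_combination x ^ k * this
  obtain ⟨e₃, he₃, h3⟩ : ∃ e : ℂ, IsIntegral (Rp p) e ∧
      P = -(3 ^ ((p - 1) / 2) * S) + p * e := by
    obtain ⟨E, hE⟩ := C_dvd_legendreAddCubic hp hp3
    refine ⟨aeval y E, hy_int.aeval_int E, ?_⟩
    have := congrArg (aeval y) hE
    simp only [legendreAddCubic, map_add, map_sub, map_pow, map_sum, map_mul, aeval_X,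
      map_natCast, map_ofNat, map_one] at this
    rw [← this, hP', hS, cubicSum, hty]
    ring
  obtain ⟨d, hd⟩ : ∃ d : ℤ, ((3 : ℂ) ^ ((p - 1) / 2)) ^ 2 = 1 + p * d := by
    have h : ((3 ^ (p - 1) - 1 : ℤ) : ZMod p) = 0 := by
      push_cast
      rw [ZMod.pow_card_sub_one_eq_one (three_ne_zero_zmod hp3), sub_self]
    obtain ⟨d, hd⟩ := (ZMod.intCast_zmod_eq_zero_iff_dvd ..).1 h
    refine ⟨d, ?_⟩
    have hodd : (p - 1) / 2 * 2 = p - 1 := by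
      have := hp.eq_two_or_odd
      omega
    have := congrArg (Int.cast : ℤ → ℂ) hd
    push_cast at this
    rw [← pow_mul, hodd]
    linear_combination this
  have hd_int : IsIntegral (Rp p) (d : ℂ) := isIntegral_intCast _
  obtain ⟨w, hw⟩ : ∃ w : ℂ, w = 3 ^ ((p - 1) / 2) := ⟨_, rfl⟩
  have hw_int : IsIntegral (Rp p) w := by
    rw [hw]
    exact_mod_cast (hint 3).pow _
  rw [← hw] at h3 hd
  rw [← hP, ← hS]
  -- The witnesses come from expanding `(P + p e₂) ^ 2 - p ^ 2 e₁` and `(-w S + p e₃) ^ 2` with `w ^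
  -- 2 = 1 + p d`.
  refine ⟨⟨2 * P * e₂ + p * e₂ ^ 2 - p * e₁, ?_, ?_⟩,
    ⟨d * S ^ 2 - 2 * w * S * e₃ + p * e₃ ^ 2, ?_, ?_⟩, ?_⟩
  · exact ((((hint 2).mul hP_int).mul he₂).add ((hint p).mul (he₂.pow 2))).sub ((hint p).mul he₁)
  · linear_combination -h1 + (F + P + p * e₂) * h2
  · exact ((hd_int.mul (hS_int.pow 2)).sub
      ((((hint 2).mul hw_int).mul hS_int).mul he₃)).add ((hint p).mul (he₃.pow 2))
  · linear_combination (P - w * S + p * e₃) * h3 + S ^ 2 * hd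
  · intro h
    obtain ⟨c, hc, hPc⟩ : ∃ c : ℂ, IsIntegral (Rp p) c ∧ P = p * c := by
      rcases h with ⟨c, hc, h⟩ | ⟨c, hc, h⟩
      · exact ⟨c, hc, by rw [← h, sub_zero]⟩
      · exact ⟨-(w * c) + e₃, (hw_int.mul hc).neg.add he₃, by linear_combination h3 - w * h⟩
    -- Here `F = p (c + e₂)`, so the quotient by `p ^ 2` is integral over `R_p`; being rational, it
    -- lies in `R_p`.
    have hr : ((binomSum p m / (p : ℚ) ^ 2 : ℚ) : ℂ) = (c + e₂) ^ 2 - e₁ := by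
      push_cast
      rw [div_eq_iff (pow_ne_zero 2 hpC)]
      linear_combination -h1 + (F + p * (c + e₂)) * h2 + (F + p * (c + e₂)) * hPc
    refine ⟨binomSum p m / (p : ℚ) ^ 2, mem_Rp_of_isIntegral_ratCast ?_, ?_⟩
    · rw [hr]
      exact ((hc.add he₂).pow 2).sub he₁
    · have hpQ : (p : ℚ) ≠ 0 := Nat.cast_ne_zero.2 hp.ne_zero
      push_cast
      field_simp
      ring
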